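/- Let $\mathbb H$ be a real separable Hilbert space (for instance $L^2[0,1]$), let $X$ be a random element of $\mathbb H$ with $\mathbb E\|X\|^4<\infty$, and let $X_1,X_2,\ldots$ be i.i.d. copies of $X$. Let $Q$ be a Borel probability measure on $\mathbb H$ that is symmetric (invariant under $f\mapsto -f$) and satisfies $\int_{\mathbb H}\|f\|^4\,Q(df)<\infty$. Write $\mu=\mathbb E X$, $\mathcal C f=\mathbb E(\langle X-\mu,f\rangle X)$, $\sigma_f^2=\langle \mathcal C f,f\rangle$, and, for $m\in\mathbb H$ and a positive trace-class operator $A$ on $\mathbb H$, $$\varphi(f;m,A)=\exp\left(i\langle m,f\rangle-\tfrac12\langle Af,f\rangle\right),\qquad f\in\mathbb H.$$ Let $\overline X_n=\frac1n\sum_{j=1}^nX_j$, $\mathcal C_nf=\frac1n\sum_{j=1}^n\langle X_j-\overline X_n,f\rangle(X_j-\overline X_n)$, and $$T_n=\int_{\mathbb H}\Big|\frac1n\sum_{j=1}^n e^{i\langle f,X_j\rangle}-\varphi(f;\overline X_n,\mathcal C_n)\Big|^2Q(df),\qquad \tau_Q=\int_{\mathbb H}\Big|\mathbb E\, e^{i\langle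 f,X\rangle}-\varphi(f;\mu,\mathcal C)\Big|^2Q(df).$$ With the centred element $Y=X-\mu$ (so $Y=X$ if $\mu=0$), put $$z(f)=\mathbb E\cos\langle f,Y\rangle+\mathbb E\sin\langle f,Y\rangle-e^{-\sigma_f^2/2},$$ $$\xi(f,x)=\cos\langle f,x\rangle-\mathbb E\cos\langle f,Y\rangle+\sin\langle f,x\rangle-\mathbb E\sin\langle f,Y\rangle+\langle f,x\rangle\,\mathbb E[\sin\langle f,Y\rangle-\cos\langle f,Y\rangle]+\tfrac12e^{-\sigma_f^2/2}\left(\langle f,x\rangle^2-\sigma_f^2\right),$$ $$K^\star(f,g)=\mathbb E[\xi(f,Y)\,\xi(g,Y)],\qquad \sigma^2=4\int_{\mathbb H}\int_{\mathbb H}K^\star(f,g)\,z(f)\,z(g)\,Q(df)\,Q(dg).$$ Then the integrals defining $K^\star$ and $\sigma^2$ converge absolutely, $\sigma^2\ge 0$, and, as $n\to\infty$, $$\sqrt n\,(T_n-\tau_Q)\ \xrightarrow{\ \mathcal D\ }\ \mathrm N(0,\sigma^2),$$ where $\mathrm N(0,0)$ is the point mass at $0$. -/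

import Mathlib

open MeasureTheory ProbabilityTheory Filter Topology
open scoped RealInnerProductSpace NNReal

noncomputable section

namespace GaussTest

variable {H : Type*} [NormedAddCommGroup H] [InnerProductSpace ℝ H]

/-- The functional `φ(f; μ, C) = exp (i⟨μ, f⟩ - ⟨C f, f⟩ / 2)`. -/
def gaussCharFun (m : H) (C : H → H) (f : H) : ℂ :=
  Complex.exp (Complex.I * (⟪m, f⟫ : ℝ) - (1 / 2 : ℂ) * (⟪C f, f⟫ : ℝ))

section Population

variable {Ω : Type*} [MeasurableSpace Ω]

/-- The expectation `E X` of a random element `X`, as a Bochner integral. -/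
def mean (X : Ω → H) (P : Measure Ω) : H := ∫ ω, X ω ∂P

/-- The covariance operator `C f = E (⟨X - E X, f⟩ X)`. -/
def covOp (X : Ω → H) (P : Measure Ω) (f : H) : H :=
  ∫ ω, ⟪X ω - mean X P, f⟫ • X ω ∂P

/-- `σ_f² = ⟨C f, f⟩`. -/
def sigmaSq (X : Ω → H) (P : Measure Ω) (f : H) : ℝ := ⟪covOp X P f, f⟫

/-- The characteristic functional `φ_X(f) = E exp (i⟨X, f⟩)`. -/
def charFunctional (X : Ω → H) (P : Measure Ω) (f : H) : ℂ :=
  ∫ ω, Complex.exp (Complex.I * (⟪X ω, f⟫ : ℝ)) ∂P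

/-- `τ_Q = ∫ |φ_X(f) - φ(f; E X, C)|² Q(df)`. -/
def tau [MeasurableSpace H] (Q : Measure H) (X : Ω → H) (P : Measure Ω) : ℝ :=
  ∫ f, ‖charFunctional X P f - gaussCharFun (mean X P) (covOp X P) f‖ ^ 2 ∂Q

/-- The centred random element `X - E X`. -/
def centred (X : Ω → H) (P : Measure Ω) (ω : Ω) : H := X ω - mean X P

/-- `z(f) = E cos⟨f, X⟩ + E sin⟨f, X⟩ - exp (-σ_f² / 2)`; meant for a centred `X`. -/
def zFun (X : Ω → H) (P : Measure Ω) (f : H) : ℝ :=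
  (∫ ω, Real.cos ⟪f, X ω⟫ ∂P) + (∫ ω, Real.sin ⟪f, X ω⟫ ∂P) - Real.exp (-(sigmaSq X P f) / 2)

/-- `ξ(f, x)`; meant for a centred `X`. -/
def xi (X : Ω → H) (P : Measure Ω) (f x : H) : ℝ :=
  Real.cos ⟪f, x⟫ - (∫ ω, Real.cos ⟪f, X ω⟫ ∂P)
    + Real.sin ⟪f, x⟫ - (∫ ω, Real.sin ⟪f, X ω⟫ ∂P)
    + ⟪f, x⟫ * (∫ ω, (Real.sin ⟪f, X ω⟫ - Real.cos ⟪f, X ω⟫) ∂P)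
    + 1 / 2 * Real.exp (-(sigmaSq X P f) / 2) * (⟪f, x⟫ ^ 2 - sigmaSq X P f)

/-- `K*(f, g) = E [ξ(f, X) ξ(g, X)]`; meant for a centred `X`. -/
def Kstar (X : Ω → H) (P : Measure Ω) (f g : H) : ℝ :=
  ∫ ω, xi X P f (X ω) * xi X P g (X ω) ∂P

end Population

section Sample

variable {n : ℕ}

/-- The sample mean. -/
def sampleMean (x : Fin n → H) : H := (n : ℝ)⁻¹ • ∑ j, x j

/-- The sample covariance operator `C_n f = n⁻¹ ∑ ⟨x_j - x̄, f⟩ (x_j - x̄)`. In `L²[0,1]` it is the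
integral operator with kernel `c_n(s,t) = n⁻¹ ∑ (x_j(s) - x̄(s)) (x_j(t) - x̄(t))`. -/
def sampleCovOp (x : Fin n → H) (f : H) : H :=
  (n : ℝ)⁻¹ • ∑ j, ⟪x j - sampleMean x, f⟫ • (x j - sampleMean x)

/-- The empirical characteristic functional `φ_n(f) = n⁻¹ ∑ exp (i⟨f, x_j⟩)`. -/
def empCharFunctional (x : Fin n → H) (f : H) : ℂ :=
  (n : ℂ)⁻¹ * ∑ j, Complex.exp (Complex.I * (⟪f, x j⟫ : ℝ))

/-- `T_n(x_1, …, x_n) = ∫ |φ_n(f) - φ(f; x̄, C_n)|² Q(df)`. -/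
def Tstat [MeasurableSpace H] (Q : Measure H) (x : Fin n → H) : ℝ :=
  ∫ f, ‖empCharFunctional x f - gaussCharFun (sampleMean x) (sampleCovOp x) f‖ ^ 2 ∂Q

end Sample

end GaussTest

end

/-
`T_n` is the functional `tau` evaluated at the empirical law of the sample, and because `Q` is
symmetric, `tau = ∫ z(f)² Q(df)`. At the law of `Y = X - μ` the function `z` has the first order
expansion `z + ∫ ξ(f, ·)` with an error bounded by squares of averages of centred kernels of
quadratic growth, and squaring gives the same for `tau`, with the influence function
`2 ∫ z(f) ξ(f, ·) Q(df)` as linear term. Under i.i.d. sampling the second moment of the mean of `n`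
centred terms is of order `1 / n`, so after multiplication by `√n` the error tends to zero in `L¹`;
the central limit theorem for the influence function and Slutsky's lemma give the limit, and Fubini
identifies the variance.
-/

namespace GaussTest

section Elementary

lemma abs_sin_sub_self_le_sq (x : ℝ) : |Real.sin x - x| ≤ x ^ 2 := by
  rw [abs_sub_comm, ← sq_abs x]
  have hcubic := Real.abs_sub_sin_le x
  have hlinear : |x - Real.sin x| ≤ |x| + 1 :=
    (abs_sub _ _).trans (add_le_add_right (Real.abs_sin_le_one x) _)
  rcases le_total |x| 6 with h | h
  · nlinarith [sq_nonneg |x|, mul_le_mul_of_nonneg_right h (sq_nonneg |x|)]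
  · nlinarith

lemma abs_cos_sub_one_le_sq_div_two (x : ℝ) : |Real.cos x - 1| ≤ x ^ 2 / 2 :=
  abs_sub_le_iff.2 ⟨by linarith [Real.cos_le_one x, sq_nonneg x],
    by linarith [Real.one_sub_sq_div_two_le_cos (x := x)]⟩

lemma abs_cos_add_sin_le_two (x y : ℝ) : |Real.cos x + Real.sin y| ≤ 2 :=
  (abs_add_le _ _).trans (by linarith [Real.abs_cos_le_one x, Real.abs_sin_le_one y])

lemma abs_sin_sub_cos_le_two (x y : ℝ) : |Real.sin x - Real.cos y| ≤ 2 :=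
  (abs_sub _ _).trans (by linarith [Real.abs_sin_le_one x, Real.abs_cos_le_one y])

lemma abs_cos_add_sin_sub_taylor_le (x m : ℝ) :
    |Real.cos (x - m) + Real.sin (x - m) - (Real.cos x + Real.sin x)
      - m * (Real.sin x - Real.cos x)| ≤ 3 * m ^ 2 := by
  calc _ = |(Real.cos x + Real.sin x) * (Real.cos m - 1)
        + (Real.sin x - Real.cos x) * (Real.sin m - m)| := by
        rw [Real.cos_sub, Real.sin_sub]; ring_nf
    _ ≤ 2 * (m ^ 2 / 2) + 2 * m ^ 2 := by
        refine (abs_add_le _ _).trans ?_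
        rw [abs_mul, abs_mul]
        gcongr
        exacts [abs_cos_add_sin_le_two x x, abs_cos_sub_one_le_sq_div_two m,
          abs_sin_sub_cos_le_two x x, abs_sin_sub_self_le_sq m]
    _ = 3 * m ^ 2 := by ring

lemma exp_neg_mul_sub_le_exp_neg_sub (u w : ℝ) :
    Real.exp (-w) * (w - u) ≤ Real.exp (-u) - Real.exp (-w) := by
  have hexp : Real.exp (-u) = Real.exp (-w) * Real.exp (w - u) := by
    rw [← Real.exp_add]; ring_nf
  have := mul_le_mul_of_nonneg_left (Real.add_one_le_exp (w - u)) (Real.exp_pos (-w)).le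
  linarith

lemma abs_exp_neg_sub_exp_neg_le {u w : ℝ} (hu : 0 ≤ u) (hw : 0 ≤ w) :
    |Real.exp (-u) - Real.exp (-w)| ≤ |u - w| := by
  have hle : ∀ x y : ℝ, 0 ≤ x → Real.exp (-x) - Real.exp (-y) ≤ |x - y| := fun x y hx =>
    calc Real.exp (-x) - Real.exp (-y) ≤ Real.exp (-x) * (y - x) := by
          linarith [exp_neg_mul_sub_le_exp_neg_sub y x]
      _ ≤ Real.exp (-x) * |x - y| := by
          gcongr
          exact abs_sub_comm y x ▸ le_abs_self (y - x)
      _ ≤ |x - y| :=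
          mul_le_of_le_one_left (abs_nonneg _) (Real.exp_le_one_iff.2 (neg_nonpos.2 hx))
  exact abs_sub_le_iff.2 ⟨hle u w hu, abs_sub_comm u w ▸ hle w u hw⟩

lemma abs_exp_neg_sub_taylor_le {u w : ℝ} (hu : 0 ≤ u) (hw : 0 ≤ w) :
    |Real.exp (-u) - Real.exp (-w) + Real.exp (-w) * (u - w)| ≤ (u - w) ^ 2 := by
  have hconvex := exp_neg_mul_sub_le_exp_neg_sub u w
  rw [abs_of_nonneg (by linarith)]
  calc _ ≤ (u - w) * (Real.exp (-w) - Real.exp (-u)) := by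
        linarith [exp_neg_mul_sub_le_exp_neg_sub w u]
    _ ≤ |u - w| * |u - w| := by
        refine (le_abs_self _).trans ?_
        rw [abs_mul, abs_sub_comm (Real.exp (-w))]
        exact mul_le_mul_of_nonneg_left (abs_exp_neg_sub_exp_neg_le hu hw) (abs_nonneg _)
    _ = (u - w) ^ 2 := by rw [abs_mul_abs_self, sq]

lemma abs_exp_neg_half_sub_taylor_le {m q v : ℝ} (hm : m ^ 2 ≤ q) (hv : 0 ≤ v) :
    |Real.exp (-(q - m ^ 2) / 2) - Real.exp (-v / 2) + 1 / 2 * Real.exp (-v / 2) * (q - v)|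
      ≤ m ^ 2 / 2 + (q - v) ^ 2 / 4 := by
  have hm0 := sq_nonneg m
  have hshift : |Real.exp (-((q - m ^ 2) / 2)) - Real.exp (-(q / 2))| ≤ m ^ 2 / 2 :=
    (abs_exp_neg_sub_exp_neg_le (by linarith) (by linarith)).trans_eq <| by
      rw [abs_of_nonpos (by linarith)]; ring
  have htaylor : |Real.exp (-(q / 2)) - Real.exp (-(v / 2))
      + Real.exp (-(v / 2)) * (q / 2 - v / 2)| ≤ (q - v) ^ 2 / 4 :=
    (abs_exp_neg_sub_taylor_le (by linarith) (by linarith)).trans_eq (by ring)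
  rw [neg_div, neg_div]
  refine le_trans (le_of_eq ?_) ((abs_add_le _ _).trans (add_le_add hshift htaylor))
  ring_nf

lemma abs_sq_sub_sq_sub_linear_le {Z z D B : ℝ} (hZ : |Z| ≤ 3) (hz : |z| ≤ 3)
    (hB : |Z - z - D| ≤ B) : |Z ^ 2 - z ^ 2 - 2 * z * D| ≤ D ^ 2 + 18 * B := by
  have hlin : |z * (Z - z - D)| ≤ 3 * B := by
    rw [abs_mul]; gcongr
  have hquad : |(Z - z) * (Z - z - D)| ≤ 6 * B := by
    rw [abs_mul]; gcongr
    exact (abs_sub _ _).trans (by linarith)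
  have hsq : (Z - z) ^ 2 ≤ D ^ 2 + 2 * ((Z - z) * (Z - z - D)) := by
    linarith [sq_nonneg (Z - z - D)]
  have hsplit : Z ^ 2 - z ^ 2 - 2 * z * D = 2 * (z * (Z - z - D)) + (Z - z) ^ 2 := by ring
  rw [abs_le] at hlin hquad
  rw [hsplit, abs_le]
  constructor <;> linarith [hlin.1, hlin.2, hquad.1, hquad.2, sq_nonneg (Z - z), sq_nonneg D]

lemma norm_exp_mul_sub_exp_sq (θ c s v : ℝ) :
    ‖Complex.exp (Complex.I * θ) * (c + s * Complex.I)
      - Complex.exp (Complex.I * θ - (1 / 2 : ℂ) * v)‖ ^ 2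
      = (c - Real.exp (-v / 2)) ^ 2 + s ^ 2 := by
  have hexp : Complex.exp (Complex.I * θ - (1 / 2 : ℂ) * v)
      = Complex.exp (Complex.I * θ) * (Real.exp (-v / 2) : ℝ) := by
    rw [Complex.ofReal_exp, ← Complex.exp_add]
    congr 1; push_cast; ring
  have hre : (c : ℂ) + s * Complex.I - (Real.exp (-v / 2) : ℝ)
      = ((c - Real.exp (-v / 2) : ℝ) : ℂ) + (s : ℝ) * Complex.I := by
    push_cast; ring
  rw [hexp, ← mul_sub, norm_mul, mul_comm Complex.I, Complex.norm_exp_ofReal_mul_I, one_mul, hre,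
    ← Complex.normSq_eq_norm_sq, Complex.normSq_add_mul_I]

end Elementary

section Symmetrization

variable {H : Type*} [AddCommGroup H] [MeasurableSpace H] [MeasurableNeg H] {Q : Measure H}

lemma integral_eq_zero_of_odd (hsymm : Q.map (fun f => -f) = Q) {u : H → ℝ}
    (hodd : ∀ f, u (-f) = -u f) : ∫ f, u f ∂Q = 0 := by
  have hneg : ∫ f, u f ∂Q = ∫ f, u (-f) ∂Q := by
    conv_lhs => rw [← hsymm]
    exact integral_map_equiv (MeasurableEquiv.neg H) u
  simp_rw [hodd, integral_neg] at hneg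
  linarith

lemma integral_sq_add_sq_of_even_of_odd (hsymm : Q.map (fun f => -f) = Q) {u s : H → ℝ}
    (hu : MemLp u 2 Q) (hs : MemLp s 2 Q) (heven : ∀ f, u (-f) = u f)
    (hodd : ∀ f, s (-f) = -s f) :
    ∫ f, (u f ^ 2 + s f ^ 2) ∂Q = ∫ f, (u f + s f) ^ 2 ∂Q := by
  have hcross : ∫ f, 2 * (u f * s f) ∂Q = 0 :=
    integral_eq_zero_of_odd hsymm fun f => by rw [heven, hodd]; ring
  calc _ = ∫ f, (u f ^ 2 + s f ^ 2) ∂Q + ∫ f, 2 * (u f * s f) ∂Q := by rw [hcross, add_zero]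
    _ = ∫ f, (u f ^ 2 + s f ^ 2 + 2 * (u f * s f)) ∂Q :=
        (integral_add (hu.integrable_sq.add hs.integrable_sq)
          ((hu.integrable_mul hs).const_mul 2)).symm
    _ = _ := by congr 1; ext f; ring

end Symmetrization

section QuadraticGrowth

variable {α β : Type*} [MeasurableSpace α] [MeasurableSpace β] {ρ : Measure α} {π : Measure β}

lemma memLp_natCast_of_integrable_norm_pow {E : Type*} [NormedAddCommGroup E] {V : α → E} {p : ℕ}
    (hp : p ≠ 0) (hV : AEStronglyMeasurable V ρ) (hint : Integrable (fun a => ‖V a‖ ^ p) ρ) :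
    MemLp V p ρ := by
  rw [← integrable_norm_rpow_iff hV (Nat.cast_ne_zero.2 hp) (ENNReal.natCast_ne_top p)]
  simpa only [ENNReal.toReal_natCast, Real.rpow_natCast] using hint

lemma memLp_one_add_norm_sq {E : Type*} [NormedAddCommGroup E] [IsFiniteMeasure ρ] {V : α → E}
    {p q : ENNReal} (hV : MemLp V q ρ) (hpq : 2 * p ≤ q) :
    MemLp (fun a => 1 + ‖V a‖ ^ 2) p ρ := by
  have h := (hV.mono_exponent hpq).norm_rpow_div 2
  rw [mul_comm, ENNReal.mul_div_cancel_right two_ne_zero ENNReal.ofNat_ne_top] at h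
  simp only [ENNReal.toReal_ofNat, Real.rpow_ofNat] at h
  exact (memLp_const (1 : ℝ)).add h

lemma memLp_mul_prod [SFinite π] {u : α → ℝ} {v : β → ℝ} {p : ENNReal} (hp₀ : p ≠ 0)
    (hp : p ≠ ⊤) (hu : MemLp u p ρ) (hv : MemLp v p π) :
    MemLp (fun z : α × β => u z.1 * v z.2) p (ρ.prod π) := by
  have hmeas : AEStronglyMeasurable (fun z : α × β => u z.1 * v z.2) (ρ.prod π) :=
    hu.1.comp_fst.mul hv.1.comp_snd
  rw [← integrable_norm_rpow_iff hmeas hp₀ hp]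
  simp_rw [norm_mul, Real.mul_rpow (norm_nonneg _) (norm_nonneg _)]
  exact (hu.integrable_norm_rpow hp₀ hp).mul_prod (hv.integrable_norm_rpow hp₀ hp)

variable {E F : Type*} [NormedAddCommGroup E] [MeasurableSpace E]
  [NormedAddCommGroup F] [MeasurableSpace F]

/-- A measurable function growing at most quadratically in the norm. -/
structure HasQuadraticGrowth (u : E → ℝ) : Prop where
  measurable : Measurable u
  exists_bound : ∃ C, ∀ x, |u x| ≤ C * (1 + ‖x‖ ^ 2)

/-- A jointly measurable kernel dominated by a product of quadratically growing functions of its two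
arguments: the integrability class of all kernels in the expansion of `tau`. -/
structure IsQuadraticKernel (h : E → F → ℝ) : Prop where
  measurable : Measurable (Function.uncurry h)
  exists_bound : ∃ C, ∀ x y, |h x y| ≤ C * ((1 + ‖x‖ ^ 2) * (1 + ‖y‖ ^ 2))

lemma HasQuadraticGrowth.memLp_comp [BorelSpace E] [IsFiniteMeasure ρ] {u : E → ℝ}
    (hu : HasQuadraticGrowth u) {V : α → E} {p q : ENNReal} (hV : MemLp V q ρ)
    (hpq : 2 * p ≤ q) : MemLp (fun a => u (V a)) p ρ := by
  obtain ⟨C, hC⟩ := hu.exists_bound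
  refine (memLp_one_add_norm_sq hV hpq).of_le_mul (c := C)
    (hu.measurable.comp_aemeasurable hV.1.aemeasurable).aestronglyMeasurable
    (ae_of_all _ fun a => ?_)
  rw [Real.norm_of_nonneg (r := 1 + _) (by positivity)]
  exact hC (V a)

lemma HasQuadraticGrowth.const_mul {u : E → ℝ} (hu : HasQuadraticGrowth u) (c : ℝ) :
    HasQuadraticGrowth (fun x => c * u x) := by
  obtain ⟨C, hC⟩ := hu.exists_bound
  refine ⟨hu.measurable.const_mul c, |c| * C, fun x => ?_⟩
  rw [abs_mul, mul_assoc]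
  exact mul_le_mul_of_nonneg_left (hC x) (abs_nonneg c)

lemma HasQuadraticGrowth.of_abs_le {u : E → ℝ} (hu : Measurable u) {B : ℝ}
    (hB : ∀ x, |u x| ≤ B) : HasQuadraticGrowth u :=
  ⟨hu, B, fun x => (hB x).trans <| le_mul_of_one_le_right ((abs_nonneg _).trans (hB x))
    (le_add_of_nonneg_right (sq_nonneg _))⟩

lemma HasQuadraticGrowth.kernel {u : E → ℝ} (hu : HasQuadraticGrowth u) :
    IsQuadraticKernel (fun x (_ : F) => u x) := by
  obtain ⟨C, hC⟩ := hu.exists_bound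
  refine ⟨hu.measurable.comp measurable_fst, C, fun x y => (hC x).trans ?_⟩
  rw [← mul_assoc]
  exact le_mul_of_one_le_right ((abs_nonneg _).trans (hC x))
    (le_add_of_nonneg_right (sq_nonneg _))

namespace IsQuadraticKernel

variable {h h₁ h₂ : E → F → ℝ}

lemma swap (hh : IsQuadraticKernel h) : IsQuadraticKernel (fun y x => h x y) := by
  obtain ⟨C, hC⟩ := hh.exists_bound
  exact ⟨hh.measurable.comp measurable_swap, C, fun y x => by
    rw [mul_comm (1 + ‖y‖ ^ 2)]; exact hC x y⟩

lemma section_right (hh : IsQuadraticKernel h) (x : E) : HasQuadraticGrowth (h x) := by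
  obtain ⟨C, hC⟩ := hh.exists_bound
  exact ⟨hh.measurable.of_uncurry_left, C * (1 + ‖x‖ ^ 2), fun y => by
    rw [mul_assoc]; exact hC x y⟩

lemma add (h₁' : IsQuadraticKernel h₁) (h₂' : IsQuadraticKernel h₂) :
    IsQuadraticKernel (fun x y => h₁ x y + h₂ x y) := by
  obtain ⟨C₁, hC₁⟩ := h₁'.exists_bound
  obtain ⟨C₂, hC₂⟩ := h₂'.exists_bound
  refine ⟨h₁'.measurable.add h₂'.measurable, C₁ + C₂, fun x y => ?_⟩
  rw [add_mul]
  exact (abs_add_le _ _).trans (add_le_add (hC₁ x y) (hC₂ x y))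

lemma bounded_mul (hh : IsQuadraticKernel h) {b : E → ℝ} (hb : Measurable b) {B : ℝ}
    (hB : ∀ x, |b x| ≤ B) : IsQuadraticKernel (fun x y => b x * h x y) := by
  obtain ⟨C, hC⟩ := hh.exists_bound
  refine ⟨(hb.comp measurable_fst).mul hh.measurable, B * C, fun x y => ?_⟩
  rw [abs_mul, mul_assoc]
  exact mul_le_mul (hB x) (hC x y) (abs_nonneg _) ((abs_nonneg _).trans (hB x))

section Integrals

variable [BorelSpace F] {W : β → F}

lemma memLp_comp [IsFiniteMeasure π] (hh : IsQuadraticKernel h) {p q : ENNReal}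
    (hW : MemLp W q π) (hpq : 2 * p ≤ q) (x : E) : MemLp (fun b => h x (W b)) p π :=
  (hh.section_right x).memLp_comp hW hpq

lemma integrable_comp [IsFiniteMeasure π] (hh : IsQuadraticKernel h) (hW : MemLp W 2 π) (x : E) :
    Integrable (fun b => h x (W b)) π :=
  (hh.memLp_comp hW (by norm_num) x).integrable le_rfl

lemma memLp_prod [BorelSpace E] [IsFiniteMeasure ρ] [IsFiniteMeasure π]
    (hh : IsQuadraticKernel h) {V : α → E} {p q : ENNReal} (hp₀ : p ≠ 0) (hp : p ≠ ⊤)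
    (hV : MemLp V q ρ) (hW : MemLp W q π) (hpq : 2 * p ≤ q) :
    MemLp (fun z : α × β => h (V z.1) (W z.2)) p (ρ.prod π) := by
  obtain ⟨C, hC⟩ := hh.exists_bound
  refine (memLp_mul_prod hp₀ hp (memLp_one_add_norm_sq hV hpq)
    (memLp_one_add_norm_sq hW hpq)).of_le_mul (c := C) ?_ (ae_of_all _ fun z => ?_)
  · exact (hh.measurable.comp_aemeasurable
      (hV.1.aemeasurable.comp_fst.prodMk hW.1.aemeasurable.comp_snd)).aestronglyMeasurable
  · rw [Real.norm_of_nonneg (r := (1 + _) * _) (by positivity)]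
    exact hC _ _

lemma integral_right [IsFiniteMeasure π] (hh : IsQuadraticKernel h) (hW : MemLp W 2 π) :
    HasQuadraticGrowth (fun x => ∫ b, h x (W b) ∂π) := by
  obtain ⟨C, hC⟩ := hh.exists_bound
  constructor
  · have hmap : (fun x => ∫ b, h x (W b) ∂π) = fun x => ∫ y, h x y ∂π.map W := by
      ext x
      exact (integral_map hW.1.aemeasurable
        (hh.section_right x).measurable.aestronglyMeasurable).symm
    rw [hmap]
    exact hh.measurable.stronglyMeasurable.integral_prod_right.measurable
  · refine ⟨C * ∫ b, (1 + ‖W b‖ ^ 2) ∂π, fun x => ?_⟩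
    have hint : Integrable (fun b => C * ((1 + ‖x‖ ^ 2) * (1 + ‖W b‖ ^ 2))) π :=
      (((memLp_one_add_norm_sq hW (by norm_num)).integrable le_rfl).const_mul _).const_mul _
    refine (norm_integral_le_of_norm_le hint (f := fun b => h x (W b))
      (ae_of_all _ fun b => hC x (W b))).trans_eq ?_
    rw [integral_const_mul, integral_const_mul]
    ring

lemma integrable_mul_prod_prod [BorelSpace E] [IsFiniteMeasure ρ] [IsFiniteMeasure π]
    (hh : IsQuadraticKernel h) {V : α → E} (hV : MemLp V 2 ρ) (hW : MemLp W 4 π) :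
    Integrable (fun z : (α × α) × β => h (V z.1.1) (W z.2) * h (V z.1.2) (W z.2))
      ((ρ.prod ρ).prod π) := by
  obtain ⟨C, hC⟩ := hh.exists_bound
  have hV' : Integrable (fun a => 1 + ‖V a‖ ^ 2) ρ :=
    (memLp_one_add_norm_sq hV (by norm_num)).integrable le_rfl
  have hW' : Integrable (fun b => (1 + ‖W b‖ ^ 2) ^ 2) π :=
    (memLp_one_add_norm_sq (p := 2) hW (by norm_num)).integrable_sq
  have hmeas : ∀ {s : (α × α) × β → α},
      Measure.QuasiMeasurePreserving s ((ρ.prod ρ).prod π) ρ →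
      AEMeasurable (fun z : (α × α) × β => h (V (s z)) (W z.2)) ((ρ.prod ρ).prod π) := fun hs =>
    hh.measurable.comp_aemeasurable
      ((hV.1.aemeasurable.comp_quasiMeasurePreserving hs).prodMk hW.1.aemeasurable.comp_snd)
  refine (((hV'.mul_prod hV').mul_prod hW').const_mul (C ^ 2)).mono'
    ((hmeas (Measure.quasiMeasurePreserving_fst.comp
      Measure.quasiMeasurePreserving_fst)).mul (hmeas (Measure.quasiMeasurePreserving_snd.comp
      Measure.quasiMeasurePreserving_fst))).aestronglyMeasurable (ae_of_all _ fun z => ?_)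
  rw [norm_mul]
  exact (mul_le_mul (hC _ _) (hC _ _) (abs_nonneg _)
    ((abs_nonneg _).trans (hC _ _))).trans_eq (by ring)

lemma integral_sq_integral [BorelSpace E] [IsFiniteMeasure ρ] [IsFiniteMeasure π]
    (hh : IsQuadraticKernel h) {V : α → E} (hV : MemLp V 2 ρ) (hW : MemLp W 4 π) :
    ∫ b, (∫ a, h (V a) (W b) ∂ρ) ^ 2 ∂π
      = ∫ a', ∫ a, (∫ b, h (V a) (W b) * h (V a') (W b) ∂π) ∂ρ ∂ρ := by
  have hint := hh.integrable_mul_prod_prod hV hW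
  calc _ = ∫ b, (∫ z : α × α, h (V z.1) (W b) * h (V z.2) (W b) ∂ρ.prod ρ) ∂π := by
        simp_rw [sq, ← integral_prod_mul]
    _ = ∫ z : α × α, (∫ b, h (V z.1) (W b) * h (V z.2) (W b) ∂π) ∂ρ.prod ρ :=
        (integral_integral_swap hint).symm
    _ = _ := integral_prod_symm _ hint.integral_prod_left

end Integrals

end IsQuadraticKernel

end QuadraticGrowth

section CentredKernel

variable {E F : Type*} [NormedAddCommGroup E] [MeasurableSpace E]
  [NormedAddCommGroup F] [MeasurableSpace F] {Ω : Type*} [MeasurableSpace Ω]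

/-- A kernel of quadratic growth all of whose sections have mean zero at the random element `Y`, so
that its averages over `n` independent copies of `Y` are of order `n ^ (-1 / 2)`. -/
structure IsCentredKernel (Y : Ω → F) (P : Measure Ω) (h : E → F → ℝ) : Prop
    extends IsQuadraticKernel h where
  integral_eq_zero : ∀ x, ∫ ω, h x (Y ω) ∂P = 0

/-- The kernel `h(x, y) - E h(x, Y)`. -/
noncomputable def centredKernel (h : E → F → ℝ) (Y : Ω → F) (P : Measure Ω) (x : E) (y : F) : ℝ :=
  h x y - ∫ ω, h x (Y ω) ∂P

variable {Y : Ω → F} {P : Measure Ω} {h h₁ h₂ : E → F → ℝ}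

lemma IsCentredKernel.bounded_mul (hh : IsCentredKernel Y P h) {b : E → ℝ} (hb : Measurable b)
    {B : ℝ} (hB : ∀ x, |b x| ≤ B) : IsCentredKernel Y P (fun x y => b x * h x y) :=
  ⟨hh.toIsQuadraticKernel.bounded_mul hb hB, fun x => by
    rw [integral_const_mul, hh.integral_eq_zero, mul_zero]⟩

variable [BorelSpace F]

lemma IsCentredKernel.add [IsFiniteMeasure P] (hY : MemLp Y 2 P) (h₁' : IsCentredKernel Y P h₁)
    (h₂' : IsCentredKernel Y P h₂) : IsCentredKernel Y P (fun x y => h₁ x y + h₂ x y) :=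
  ⟨h₁'.toIsQuadraticKernel.add h₂'.toIsQuadraticKernel, fun x => by
    rw [integral_add (h₁'.integrable_comp hY x) (h₂'.integrable_comp hY x),
      h₁'.integral_eq_zero, h₂'.integral_eq_zero, add_zero]⟩

lemma IsQuadraticKernel.isCentredKernel_centredKernel [IsProbabilityMeasure P]
    (hh : IsQuadraticKernel h) (hY : MemLp Y 2 P) :
    IsCentredKernel Y P (centredKernel h Y P) := by
  refine ⟨?_, fun x => ?_⟩
  · have hmean := ((hh.integral_right hY).const_mul (-1)).kernel (F := F)
    convert hh.add hmean using 3 with x y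
    rw [centredKernel, neg_one_mul, sub_eq_add_neg]
  · simp only [centredKernel]
    rw [integral_sub (hh.integrable_comp hY x) (integrable_const _), integral_const,
      probReal_univ, one_smul, sub_self]

lemma integral_centredKernel {α : Type*} [MeasurableSpace α]
    {ρ : Measure α} [IsProbabilityMeasure ρ] {W : α → F} (hh : IsQuadraticKernel h)
    (hW : MemLp W 2 ρ) (x : E) :
    ∫ a, centredKernel h Y P x (W a) ∂ρ = ∫ a, h x (W a) ∂ρ - ∫ ω, h x (Y ω) ∂P := by
  simp only [centredKernel]
  rw [integral_sub (hh.integrable_comp hW x) (integrable_const _), integral_const,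
    probReal_univ, one_smul]

end CentredKernel

section RealExpansion

variable {α : Type*} [MeasurableSpace α] {ρ : Measure α} {a : α → ℝ}

lemma integrable_cos_comp [IsFiniteMeasure ρ] (ha : AEStronglyMeasurable a ρ) :
    Integrable (fun t => Real.cos (a t)) ρ :=
  .of_bound (Real.continuous_cos.comp_aestronglyMeasurable ha) 1
    (ae_of_all _ fun _ => Real.abs_cos_le_one _)

lemma integrable_sin_comp [IsFiniteMeasure ρ] (ha : AEStronglyMeasurable a ρ) :
    Integrable (fun t => Real.sin (a t)) ρ :=
  .of_bound (Real.continuous_sin.comp_aestronglyMeasurable ha) 1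
    (ae_of_all _ fun _ => Real.abs_sin_le_one _)

lemma abs_integral_cos_add_integral_sin_sub_taylor_le [IsProbabilityMeasure ρ]
    (ha : AEStronglyMeasurable a ρ) (m : ℝ) :
    |(∫ t, Real.cos (a t - m) ∂ρ) + (∫ t, Real.sin (a t - m) ∂ρ)
        - ((∫ t, Real.cos (a t) ∂ρ) + ∫ t, Real.sin (a t) ∂ρ)
        - m * ((∫ t, Real.sin (a t) ∂ρ) - ∫ t, Real.cos (a t) ∂ρ)| ≤ 3 * m ^ 2 := by
  have ham : AEStronglyMeasurable (fun t => a t - m) ρ := ha.sub aestronglyMeasurable_const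
  have hc := integrable_cos_comp ha
  have hs := integrable_sin_comp ha
  have hcm := integrable_cos_comp ham
  have hsm := integrable_sin_comp ham
  have hcombine : (∫ t, Real.cos (a t - m) ∂ρ) + (∫ t, Real.sin (a t - m) ∂ρ)
        - ((∫ t, Real.cos (a t) ∂ρ) + ∫ t, Real.sin (a t) ∂ρ)
        - m * ((∫ t, Real.sin (a t) ∂ρ) - ∫ t, Real.cos (a t) ∂ρ)
      = ∫ t, (Real.cos (a t - m) + Real.sin (a t - m) - (Real.cos (a t) + Real.sin (a t))
        - m * (Real.sin (a t) - Real.cos (a t))) ∂ρ := by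
    rw [integral_sub, integral_sub, integral_add, integral_add, integral_const_mul, integral_sub]
      <;> fun_prop
  rw [hcombine]
  refine (norm_integral_le_of_norm_le_const (G := ℝ) (C := 3 * m ^ 2)
    (ae_of_all ρ fun t => ?_)).trans_eq (by rw [probReal_univ, mul_one])
  exact abs_cos_add_sin_sub_taylor_le (a t) m

lemma abs_expansion_remainder_le [IsProbabilityMeasure ρ] (ha : MemLp a 2 ρ) (c s : ℝ) {v : ℝ}
    (hv : 0 ≤ v) :
    |(∫ t, Real.cos (a t - ∫ t, a t ∂ρ) ∂ρ) + (∫ t, Real.sin (a t - ∫ t, a t ∂ρ) ∂ρ)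
        - Real.exp (-Var[a; ρ] / 2) - (c + s - Real.exp (-v / 2))
        - ∫ t, (Real.cos (a t) - c + Real.sin (a t) - s + a t * (s - c)
            + 1 / 2 * Real.exp (-v / 2) * (a t ^ 2 - v)) ∂ρ|
      ≤ 4 * (∫ t, a t ∂ρ) ^ 2 + ((∫ t, (Real.sin (a t) - Real.cos (a t)) ∂ρ) - (s - c)) ^ 2
        + ((∫ t, a t ^ 2 ∂ρ) - v) ^ 2 := by
  have hvar : Var[a; ρ] = (∫ t, a t ^ 2 ∂ρ) - (∫ t, a t ∂ρ) ^ 2 := variance_eq_sub ha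
  have hlin : ∫ t, (Real.cos (a t) - c + Real.sin (a t) - s + a t * (s - c)
        + 1 / 2 * Real.exp (-v / 2) * (a t ^ 2 - v)) ∂ρ
      = (∫ t, Real.cos (a t) ∂ρ) - c + (∫ t, Real.sin (a t) ∂ρ) - s + (∫ t, a t ∂ρ) * (s - c)
        + 1 / 2 * Real.exp (-v / 2) * ((∫ t, a t ^ 2 ∂ρ) - v) := by
    have hcos := integrable_cos_comp ha.1
    have hsin := integrable_sin_comp ha.1
    have haI := ha.integrable one_le_two
    have hsq := ha.integrable_sq
    rw [integral_add, integral_add, integral_sub, integral_add, integral_sub, integral_mul_const,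
      integral_const_mul, integral_sub]
    · simp only [integral_const, probReal_univ, one_smul]
    all_goals fun_prop
  have htrig := abs_integral_cos_add_integral_sin_sub_taylor_le ha.1 (∫ t, a t ∂ρ)
  have hexp := abs_exp_neg_half_sub_taylor_le (by linarith [variance_nonneg a ρ]) hv
    (m := ∫ t, a t ∂ρ) (q := ∫ t, a t ^ 2 ∂ρ)
  rw [hlin, hvar, integral_sub (integrable_sin_comp ha.1) (integrable_cos_comp ha.1)]
  set m := ∫ t, a t ∂ρ
  set d := (∫ t, Real.sin (a t) ∂ρ) - (∫ t, Real.cos (a t) ∂ρ) - (s - c) with hd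
  have hmd : |m * d| ≤ m ^ 2 / 2 + d ^ 2 / 2 :=
    abs_le.2 ⟨by linarith [sq_nonneg (m + d)], by linarith [sq_nonneg (m - d)]⟩
  rw [abs_le] at *
  constructor <;> linarith [sq_nonneg d, sq_nonneg ((∫ t, a t ^ 2 ∂ρ) - v)]

end RealExpansion

section RandomElement

variable {H : Type*} [NormedAddCommGroup H] [InnerProductSpace ℝ H] [CompleteSpace H]
  {Ω : Type*} [MeasurableSpace Ω] {P : Measure Ω} [IsProbabilityMeasure P] {X Y : Ω → H}

lemma mean_sub_const (hX : Integrable X P) (c : H) :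
    mean (fun ω => X ω - c) P = mean X P - c := by
  simp only [mean]
  rw [integral_sub hX (integrable_const c), integral_const, probReal_univ, one_smul]

lemma mean_centred (hX : Integrable X P) : mean (centred X P) P = 0 := by
  rw [← sub_self (mean X P)]
  exact mean_sub_const hX _

lemma centred_sub_const (hX : Integrable X P) (c : H) :
    centred (fun ω => X ω - c) P = centred X P := by
  ext ω
  rw [centred, centred, mean_sub_const hX, sub_sub_sub_cancel_right]

omit [CompleteSpace H] in
lemma memLp_centred {p : ENNReal} (hX : MemLp X p P) : MemLp (centred X P) p P :=
  hX.sub (memLp_const _)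

lemma sigmaSq_eq_variance (hX : MemLp X 2 P) (f : H) :
    sigmaSq X P f = Var[fun ω => ⟪f, X ω⟫; P] := by
  have hf : MemLp (fun ω => ⟪f, X ω⟫) 2 P := hX.const_inner f
  have hmean : ∫ ω, ⟪f, X ω⟫ ∂P = ⟪f, mean X P⟫ := integral_inner (hX.integrable one_le_two) f
  have hint : Integrable (fun ω => ⟪X ω - mean X P, f⟫ • X ω) P :=
    memLp_one_iff_integrable.1 (hX.smul ((memLp_centred hX).inner_const f))
  calc sigmaSq X P f = ∫ ω, ⟪f, ⟪X ω - mean X P, f⟫ • X ω⟫ ∂P := by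
        rw [sigmaSq, real_inner_comm, covOp, integral_inner hint]
    _ = ∫ ω, (⟪f, X ω⟫ ^ 2 - ⟪f, mean X P⟫ * ⟪f, X ω⟫) ∂P := by
        congr with ω
        rw [inner_smul_right, inner_sub_left, real_inner_comm f, real_inner_comm f]
        ring
    _ = Var[fun ω => ⟪f, X ω⟫; P] := by
        have hvar : Var[fun ω => ⟪f, X ω⟫; P] = (∫ ω, ⟪f, X ω⟫ ^ 2 ∂P) - (∫ ω, ⟪f, X ω⟫ ∂P) ^ 2 :=
          variance_eq_sub hf
        rw [hvar, integral_sub hf.integrable_sq ((hf.integrable one_le_two).const_mul _),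
          integral_const_mul, hmean, sq ⟪f, mean X P⟫]

lemma sigmaSq_nonneg (hX : MemLp X 2 P) (f : H) : 0 ≤ sigmaSq X P f :=
  (variance_nonneg _ P).trans_eq (sigmaSq_eq_variance hX f).symm

lemma sigmaSq_centred (hX : MemLp X 2 P) (f : H) :
    sigmaSq (centred X P) P f = sigmaSq X P f := by
  rw [sigmaSq_eq_variance hX, sigmaSq_eq_variance (memLp_centred hX),
    ← variance_sub_const (hX.const_inner f).1 ⟪f, mean X P⟫]
  simp only [centred, inner_sub_right]

omit [IsProbabilityMeasure P] in
lemma integral_inner_eq_zero (hY : Integrable Y P) (hY₀ : mean Y P = 0) (f : H) :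
    ∫ ω, ⟪f, Y ω⟫ ∂P = 0 :=
  (integral_inner hY f).trans ((congrArg (inner ℝ f) hY₀).trans (inner_zero_right f))

lemma sigmaSq_eq_integral_sq (hY : MemLp Y 2 P) (hY₀ : mean Y P = 0) (f : H) :
    sigmaSq Y P f = ∫ ω, ⟪f, Y ω⟫ ^ 2 ∂P := by
  rw [sigmaSq_eq_variance hY, variance_of_integral_eq_zero (hY.const_inner f).1.aemeasurable
    (integral_inner_eq_zero (hY.integrable one_le_two) hY₀ f)]

omit [CompleteSpace H] in
lemma abs_integral_cos_inner_le_one (Y : Ω → H) (f : H) : |∫ ω, Real.cos ⟪f, Y ω⟫ ∂P| ≤ 1 :=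
  (norm_integral_le_of_norm_le_const (G := ℝ)
    (ae_of_all P fun _ => Real.abs_cos_le_one _)).trans_eq (by rw [probReal_univ, mul_one])

omit [CompleteSpace H] in
lemma abs_integral_sin_inner_le_one (Y : Ω → H) (f : H) : |∫ ω, Real.sin ⟪f, Y ω⟫ ∂P| ≤ 1 :=
  (norm_integral_le_of_norm_le_const (G := ℝ)
    (ae_of_all P fun _ => Real.abs_sin_le_one _)).trans_eq (by rw [probReal_univ, mul_one])

lemma abs_exp_neg_sigmaSq_div_two_le_one (hX : MemLp X 2 P) (f : H) :
    |Real.exp (-(sigmaSq X P f) / 2)| ≤ 1 := by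
  rw [Real.abs_exp, Real.exp_le_one_iff]
  linarith [sigmaSq_nonneg hX f]

lemma abs_zFun_le_three (hX : MemLp X 2 P) (f : H) : |zFun X P f| ≤ 3 := by
  refine (abs_sub _ _).trans ?_
  linarith [abs_add_le (∫ ω, Real.cos ⟪f, X ω⟫ ∂P) (∫ ω, Real.sin ⟪f, X ω⟫ ∂P),
    abs_integral_cos_inner_le_one (P := P) X f, abs_integral_sin_inner_le_one (P := P) X f,
    abs_exp_neg_sigmaSq_div_two_le_one hX f]

omit [CompleteSpace H] in
lemma charFunctional_eq_exp_mul (hX : AEStronglyMeasurable X P) (f : H) :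
    charFunctional X P f = Complex.exp (Complex.I * (⟪mean X P, f⟫ : ℝ))
      * ((∫ ω, Real.cos ⟪f, centred X P ω⟫ ∂P : ℝ)
        + (∫ ω, Real.sin ⟪f, centred X P ω⟫ ∂P : ℝ) * Complex.I) := by
  have hf : AEStronglyMeasurable (fun ω => ⟪f, centred X P ω⟫) P :=
    aestronglyMeasurable_const.inner (hX.sub aestronglyMeasurable_const)
  have hcos := integrable_cos_comp hf
  have hsin := integrable_sin_comp hf
  rw [← integral_complex_ofReal, ← integral_complex_ofReal, ← integral_mul_const,
    ← integral_add hcos.ofReal (hsin.ofReal.mul_const _), ← integral_const_mul, charFunctional]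
  congr 1
  ext ω
  have hsplit : ⟪X ω, f⟫ = ⟪mean X P, f⟫ + ⟪f, centred X P ω⟫ := by
    rw [real_inner_comm _ f, ← inner_add_left, centred, add_sub_cancel]
  rw [hsplit, Complex.ofReal_add, mul_add, Complex.exp_add, Complex.ofReal_cos, Complex.ofReal_sin,
    ← Complex.exp_mul_I, mul_comm Complex.I (⟪f, centred X P ω⟫ : ℂ)]

lemma norm_charFunctional_sub_gaussCharFun_sq (hX : MemLp X 2 P) (f : H) :
    ‖charFunctional X P f - gaussCharFun (mean X P) (covOp X P) f‖ ^ 2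
      = ((∫ ω, Real.cos ⟪f, centred X P ω⟫ ∂P) - Real.exp (-(sigmaSq (centred X P) P f) / 2)) ^ 2
        + (∫ ω, Real.sin ⟪f, centred X P ω⟫ ∂P) ^ 2 := by
  rw [charFunctional_eq_exp_mul hX.1, sigmaSq_centred hX, ← norm_exp_mul_sub_exp_sq, gaussCharFun,
    sigmaSq]

section Measurability

variable [SecondCountableTopology H] [MeasurableSpace H] [BorelSpace H]

omit [CompleteSpace H] in
lemma isQuadraticKernel_comp_inner {g : ℝ → ℝ} (hg : HasQuadraticGrowth g) :
    IsQuadraticKernel (fun f y : H => g ⟪f, y⟫) := by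
  obtain ⟨C, hC⟩ := hg.exists_bound
  refine ⟨hg.measurable.comp (measurable_fst.inner measurable_snd), C, fun f y => ?_⟩
  have hC₀ : 0 ≤ C := by simpa using (abs_nonneg _).trans (hC 0)
  refine (hC _).trans (mul_le_mul_of_nonneg_left ?_ hC₀)
  have hcs : ‖⟪f, y⟫‖ ^ 2 ≤ (‖f‖ * ‖y‖) ^ 2 := by
    gcongr
    exact norm_inner_le_norm f y
  nlinarith [sq_nonneg ‖f‖, sq_nonneg ‖y‖]

omit [CompleteSpace H] in
lemma measurable_integral_comp_inner {g : ℝ → ℝ} (hg : HasQuadraticGrowth g) (hY : MemLp Y 2 P) :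
    Measurable fun f => ∫ ω, g ⟪f, Y ω⟫ ∂P :=
  ((isQuadraticKernel_comp_inner hg).integral_right hY).measurable

lemma hasQuadraticGrowth_cos : HasQuadraticGrowth Real.cos :=
  .of_abs_le Real.measurable_cos Real.abs_cos_le_one

lemma hasQuadraticGrowth_sin : HasQuadraticGrowth Real.sin :=
  .of_abs_le Real.measurable_sin Real.abs_sin_le_one

lemma hasQuadraticGrowth_sin_sub_cos : HasQuadraticGrowth fun t => Real.sin t - Real.cos t :=
  .of_abs_le (Real.measurable_sin.sub Real.measurable_cos) fun t => abs_sin_sub_cos_le_two t t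

lemma hasQuadraticGrowth_id : HasQuadraticGrowth (fun t : ℝ => t) :=
  ⟨measurable_id, 1, fun t => abs_le.2 (by
    rw [Real.norm_eq_abs, sq_abs]
    constructor <;> nlinarith [sq_nonneg (t + 1), sq_nonneg (t - 1)])⟩

lemma hasQuadraticGrowth_sq : HasQuadraticGrowth (fun t : ℝ => t ^ 2) :=
  ⟨measurable_id.pow_const 2, 1, fun t => by
    rw [Real.norm_eq_abs, sq_abs, abs_of_nonneg (sq_nonneg t)]; linarith⟩

lemma measurable_sigmaSq (hY : MemLp Y 2 P) (hY₀ : mean Y P = 0) :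
    Measurable (sigmaSq Y P) := by
  rw [funext (sigmaSq_eq_integral_sq hY hY₀)]
  exact measurable_integral_comp_inner hasQuadraticGrowth_sq hY

lemma measurable_exp_neg_sigmaSq_div_two (hY : MemLp Y 2 P) (hY₀ : mean Y P = 0) :
    Measurable fun f => Real.exp (-(sigmaSq Y P f) / 2) :=
  ((measurable_sigmaSq hY hY₀).neg.div_const 2).exp

lemma measurable_zFun (hY : MemLp Y 2 P) (hY₀ : mean Y P = 0) : Measurable (zFun Y P) :=
  ((measurable_integral_comp_inner hasQuadraticGrowth_cos hY).add
    (measurable_integral_comp_inner hasQuadraticGrowth_sin hY)).sub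
    (measurable_exp_neg_sigmaSq_div_two hY hY₀)

/- Symmetry of `Q` kills the cross term between the even part `E cos⟨f, Y⟩ - exp (-σ_f² / 2)` and
the odd part `E sin⟨f, Y⟩` of `z`. -/
lemma tau_eq_integral_zFun_sq {Q : Measure H} [IsFiniteMeasure Q]
    (hsymm : Q.map (fun f => -f) = Q) (hX : MemLp X 2 P) :
    tau Q X P = ∫ f, zFun (centred X P) P f ^ 2 ∂Q := by
  have hY := memLp_centred hX
  have hY₀ := mean_centred (hX.integrable one_le_two)
  set Y := centred X P with hYdef
  have hcos : MemLp (fun f => ∫ ω, Real.cos ⟪f, Y ω⟫ ∂P) 2 Q :=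
    .of_bound (measurable_integral_comp_inner hasQuadraticGrowth_cos hY).aestronglyMeasurable 1
      (ae_of_all _ (abs_integral_cos_inner_le_one Y))
  have hsin : MemLp (fun f => ∫ ω, Real.sin ⟪f, Y ω⟫ ∂P) 2 Q :=
    .of_bound (measurable_integral_comp_inner hasQuadraticGrowth_sin hY).aestronglyMeasurable 1
      (ae_of_all _ (abs_integral_sin_inner_le_one Y))
  have hexp : MemLp (fun f => Real.exp (-(sigmaSq Y P f) / 2)) 2 Q :=
    .of_bound (measurable_exp_neg_sigmaSq_div_two hY hY₀).aestronglyMeasurable 1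
      (ae_of_all _ (abs_exp_neg_sigmaSq_div_two_le_one hY))
  calc tau Q X P = ∫ f, (((∫ ω, Real.cos ⟪f, Y ω⟫ ∂P) - Real.exp (-(sigmaSq Y P f) / 2)) ^ 2
        + (∫ ω, Real.sin ⟪f, Y ω⟫ ∂P) ^ 2) ∂Q := by
        simp only [tau, norm_charFunctional_sub_gaussCharFun_sq hX, hYdef]
    _ = ∫ f, ((∫ ω, Real.cos ⟪f, Y ω⟫ ∂P) - Real.exp (-(sigmaSq Y P f) / 2)
        + ∫ ω, Real.sin ⟪f, Y ω⟫ ∂P) ^ 2 ∂Q :=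
        integral_sq_add_sq_of_even_of_odd hsymm (hcos.sub hexp) hsin
          (fun f => by simp [sigmaSq_eq_integral_sq hY hY₀])
          (fun f => by simp [integral_neg])
    _ = ∫ f, zFun Y P f ^ 2 ∂Q := by
        congr with f
        rw [zFun, sub_add_eq_add_sub]

end Measurability

end RandomElement

section Influence

variable {H : Type*} [NormedAddCommGroup H] [InnerProductSpace ℝ H]
  {Ω : Type*} [MeasurableSpace Ω] {P : Measure Ω} {Y : Ω → H}

lemma integral_zFun_mul_xi_mul_zFun_mul_xi (Y : Ω → H) (f g : H) :
    ∫ ω, zFun Y P f * xi Y P f (Y ω) * (zFun Y P g * xi Y P g (Y ω)) ∂P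
      = Kstar Y P f g * zFun Y P f * zFun Y P g := by
  rw [Kstar, mul_assoc, ← integral_mul_const]
  congr with ω
  ring

variable [CompleteSpace H] [SecondCountableTopology H] [MeasurableSpace H] [BorelSpace H]

lemma isCentredKernel_inner (hY : Integrable Y P) (hY₀ : mean Y P = 0) :
    IsCentredKernel Y P (fun f y : H => ⟪f, y⟫) :=
  ⟨isQuadraticKernel_comp_inner hasQuadraticGrowth_id, integral_inner_eq_zero hY hY₀⟩

variable [IsProbabilityMeasure P]

omit [CompleteSpace H] in
lemma isCentredKernel_centredKernel_comp_inner {g : ℝ → ℝ} (hg : HasQuadraticGrowth g)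
    (hY : MemLp Y 2 P) : IsCentredKernel Y P (centredKernel (fun f y => g ⟪f, y⟫) Y P) :=
  (isQuadraticKernel_comp_inner hg).isCentredKernel_centredKernel hY

lemma isCentredKernel_xi (hY : MemLp Y 2 P) (hY₀ : mean Y P = 0) :
    IsCentredKernel Y P (xi Y P) := by
  have hcos := isCentredKernel_centredKernel_comp_inner hasQuadraticGrowth_cos hY
  have hsin := isCentredKernel_centredKernel_comp_inner hasQuadraticGrowth_sin hY
  have hlin := (isCentredKernel_inner (hY.integrable one_le_two) hY₀).bounded_mul (B := 2)
    (measurable_integral_comp_inner hasQuadraticGrowth_sin_sub_cos hY) fun f =>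
      (norm_integral_le_of_norm_le_const (G := ℝ) (ae_of_all P fun _ =>
        abs_sin_sub_cos_le_two _ _)).trans_eq (by rw [probReal_univ, mul_one])
  have hquad := (isCentredKernel_centredKernel_comp_inner hasQuadraticGrowth_sq hY).bounded_mul
    (B := 1 / 2 * 1) ((measurable_exp_neg_sigmaSq_div_two hY hY₀).const_mul (1 / 2)) fun f => by
      rw [abs_mul, abs_of_pos one_half_pos]
      gcongr
      exact abs_exp_neg_sigmaSq_div_two_le_one hY f
  convert ((hcos.add hY hsin).add hY hlin).add hY hquad using 3 with f y
  simp only [xi, centredKernel, sigmaSq_eq_integral_sq hY hY₀]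
  ring

lemma isCentredKernel_zFun_mul_xi (hY : MemLp Y 2 P) (hY₀ : mean Y P = 0) :
    IsCentredKernel Y P (fun f y => zFun Y P f * xi Y P f y) :=
  (isCentredKernel_xi hY hY₀).bounded_mul (measurable_zFun hY hY₀) (abs_zFun_le_three hY)

/-- The influence function `y ↦ 2 ∫ z(f) ξ(f, y) Q(df)` of the functional `tau Q` at the law of the
centred random element `Y`. -/
noncomputable def influence (Q : Measure H) (Y : Ω → H) (P : Measure Ω) (y : H) : ℝ :=
  2 * ∫ f, zFun Y P f * xi Y P f y ∂Q

variable {Q : Measure H} [IsFiniteMeasure Q]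

lemma hasQuadraticGrowth_influence (hY : MemLp Y 2 P) (hY₀ : mean Y P = 0)
    (hQ : MemLp id 2 Q) : HasQuadraticGrowth (influence Q Y P) :=
  ((isCentredKernel_zFun_mul_xi hY hY₀).swap.integral_right hQ).const_mul 2

lemma integral_influence_comp {α : Type*} [MeasurableSpace α] {ρ : Measure α} [IsFiniteMeasure ρ]
    {W : α → H} (hY : MemLp Y 2 P) (hY₀ : mean Y P = 0) (hQ : MemLp id 2 Q) (hW : MemLp W 2 ρ) :
    ∫ a, influence Q Y P (W a) ∂ρ = 2 * ∫ f, zFun Y P f * ∫ a, xi Y P f (W a) ∂ρ ∂Q := by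
  have hint : Integrable (fun p : H × α => zFun Y P p.1 * xi Y P p.1 (W p.2)) (Q.prod ρ) :=
    ((isCentredKernel_zFun_mul_xi hY hY₀).memLp_prod one_ne_zero ENNReal.one_ne_top hQ hW
      (by norm_num)).integrable le_rfl
  simp only [influence]
  rw [integral_const_mul, ← integral_integral_swap hint]
  simp_rw [integral_const_mul]

lemma integral_influence_eq_zero (hY : MemLp Y 2 P) (hY₀ : mean Y P = 0) (hQ : MemLp id 2 Q) :
    ∫ ω, influence Q Y P (Y ω) ∂P = 0 := by
  rw [integral_influence_comp hY hY₀ hQ hY]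
  simp only [(isCentredKernel_xi hY hY₀).integral_eq_zero, mul_zero, integral_zero]

lemma integrable_xi_mul_xi (hY : MemLp Y 4 P) (hY₀ : mean Y P = 0) (f g : H) :
    Integrable (fun ω => xi Y P f (Y ω) * xi Y P g (Y ω)) P := by
  have hxi := isCentredKernel_xi (hY.mono_exponent (by norm_num)) hY₀
  have hsec : ∀ f, MemLp (fun ω => xi Y P f (Y ω)) 2 P := hxi.memLp_comp hY (by norm_num)
  exact (hsec f).integrable_mul (hsec g)

lemma integrable_Kstar_mul_zFun_mul_zFun (hY : MemLp Y 4 P) (hY₀ : mean Y P = 0)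
    (hQ : MemLp id 2 Q) :
    Integrable (fun p : H × H => Kstar Y P p.1 p.2 * zFun Y P p.1 * zFun Y P p.2)
      (Q.prod Q) := by
  simp_rw [← integral_zFun_mul_xi_mul_zFun_mul_xi]
  exact ((isCentredKernel_zFun_mul_xi (hY.mono_exponent (by norm_num))
    hY₀).integrable_mul_prod_prod hQ hY).integral_prod_left

lemma integral_influence_sq (hY : MemLp Y 4 P) (hY₀ : mean Y P = 0) (hQ : MemLp id 2 Q) :
    ∫ ω, influence Q Y P (Y ω) ^ 2 ∂P
      = 4 * ∫ g, ∫ f, Kstar Y P f g * zFun Y P f * zFun Y P g ∂Q ∂Q := by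
  simp_rw [← integral_zFun_mul_xi_mul_zFun_mul_xi, influence, mul_pow, integral_const_mul]
  norm_num only
  exact congrArg (4 * ·) ((isCentredKernel_zFun_mul_xi (hY.mono_exponent (by norm_num))
    hY₀).integral_sq_integral hQ hY)

end Influence

section VonMises

variable {H : Type*} [NormedAddCommGroup H] [InnerProductSpace ℝ H] [CompleteSpace H]
  {Ω : Type*} [MeasurableSpace Ω] {P : Measure Ω} [IsProbabilityMeasure P] {X Y : Ω → H}
  {α : Type*} [MeasurableSpace α] {ρ : Measure α} [IsProbabilityMeasure ρ] {W : α → H}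

lemma zFun_centred (hW : MemLp W 2 ρ) (f : H) :
    zFun (centred W ρ) ρ f = (∫ a, Real.cos (⟪f, W a⟫ - ∫ a, ⟪f, W a⟫ ∂ρ) ∂ρ)
      + (∫ a, Real.sin (⟪f, W a⟫ - ∫ a, ⟪f, W a⟫ ∂ρ) ∂ρ)
      - Real.exp (-Var[fun a => ⟪f, W a⟫; ρ] / 2) := by
  rw [zFun, sigmaSq_centred hW, sigmaSq_eq_variance hW,
    integral_inner (hW.integrable one_le_two)]
  simp only [centred, mean, inner_sub_right]

omit [CompleteSpace H] in
lemma integral_sin_inner_sub_cos_inner (hY : AEStronglyMeasurable Y P) (f : H) :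
    ∫ ω, (Real.sin ⟪f, Y ω⟫ - Real.cos ⟪f, Y ω⟫) ∂P
      = (∫ ω, Real.sin ⟪f, Y ω⟫ ∂P) - ∫ ω, Real.cos ⟪f, Y ω⟫ ∂P :=
  integral_sub (integrable_sin_comp (aestronglyMeasurable_const.inner hY))
    (integrable_cos_comp (aestronglyMeasurable_const.inner hY))

lemma abs_zFun_centred_sub_zFun_sub_integral_xi_le (hY : MemLp Y 2 P) (hW : MemLp W 2 ρ) (f : H) :
    |zFun (centred W ρ) ρ f - zFun Y P f - ∫ a, xi Y P f (W a) ∂ρ|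
      ≤ 4 * (∫ a, ⟪f, W a⟫ ∂ρ) ^ 2
        + ((∫ a, (Real.sin ⟪f, W a⟫ - Real.cos ⟪f, W a⟫) ∂ρ)
          - ∫ ω, (Real.sin ⟪f, Y ω⟫ - Real.cos ⟪f, Y ω⟫) ∂P) ^ 2
        + ((∫ a, ⟪f, W a⟫ ^ 2 ∂ρ) - sigmaSq Y P f) ^ 2 := by
  have h := abs_expansion_remainder_le (hW.const_inner f) (∫ ω, Real.cos ⟪f, Y ω⟫ ∂P)
    (∫ ω, Real.sin ⟪f, Y ω⟫ ∂P) (sigmaSq_nonneg hY f)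
  rw [zFun_centred hW]
  simpa only [zFun, xi, integral_sin_inner_sub_cos_inner hY.1] using h

variable [SecondCountableTopology H] [MeasurableSpace H] [BorelSpace H]

/-- The centred kernels whose averages control the error of the first order expansion of `tau`:
`ξ(f, y)` itself, `⟨f, y⟩`, and the centred versions of `sin⟨f, y⟩ - cos⟨f, y⟩` and `⟨f, y⟩ ^ 2`. -/
noncomputable def fluctuationKernel (Y : Ω → H) (P : Measure Ω) : Fin 4 → H → H → ℝ :=
  ![xi Y P, fun f y => ⟪f, y⟫,
    centredKernel (fun f y => Real.sin ⟪f, y⟫ - Real.cos ⟪f, y⟫) Y P,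
    centredKernel (fun f y => ⟪f, y⟫ ^ 2) Y P]

lemma isCentredKernel_fluctuationKernel (hY : MemLp Y 2 P) (hY₀ : mean Y P = 0) (i : Fin 4) :
    IsCentredKernel Y P (fluctuationKernel Y P i) := by
  fin_cases i
  exacts [isCentredKernel_xi hY hY₀, isCentredKernel_inner (hY.integrable one_le_two) hY₀,
    isCentredKernel_centredKernel_comp_inner hasQuadraticGrowth_sin_sub_cos hY,
    isCentredKernel_centredKernel_comp_inner hasQuadraticGrowth_sq hY]

lemma abs_zFun_centred_sq_sub_zFun_sq_sub_le (hY : MemLp Y 2 P) (hY₀ : mean Y P = 0)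
    (hW : MemLp W 2 ρ) (f : H) :
    |zFun (centred W ρ) ρ f ^ 2 - zFun Y P f ^ 2 - 2 * zFun Y P f * ∫ a, xi Y P f (W a) ∂ρ|
      ≤ 72 * ∑ i, (∫ a, fluctuationKernel Y P i f (W a) ∂ρ) ^ 2 := by
  have hsum : ∑ i, (∫ a, fluctuationKernel Y P i f (W a) ∂ρ) ^ 2
      = (∫ a, xi Y P f (W a) ∂ρ) ^ 2 + (∫ a, ⟪f, W a⟫ ∂ρ) ^ 2
        + ((∫ a, (Real.sin ⟪f, W a⟫ - Real.cos ⟪f, W a⟫) ∂ρ)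
          - ∫ ω, (Real.sin ⟪f, Y ω⟫ - Real.cos ⟪f, Y ω⟫) ∂P) ^ 2
        + ((∫ a, ⟪f, W a⟫ ^ 2 ∂ρ) - sigmaSq Y P f) ^ 2 := by
    rw [Fin.sum_univ_four, sigmaSq_eq_integral_sq hY hY₀,
      ← integral_centredKernel (isQuadraticKernel_comp_inner hasQuadraticGrowth_sin_sub_cos) hW,
      ← integral_centredKernel (isQuadraticKernel_comp_inner hasQuadraticGrowth_sq) hW]
    rfl
  have hexp := abs_zFun_centred_sub_zFun_sub_integral_xi_le hY hW f
  have hsq := abs_sq_sub_sq_sub_linear_le (abs_zFun_le_three (memLp_centred hW) f)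
    (abs_zFun_le_three hY f) hexp
  rw [hsum]
  refine hsq.trans ?_
  linarith [sq_nonneg (∫ a, xi Y P f (W a) ∂ρ),
    sq_nonneg ((∫ a, (Real.sin ⟪f, W a⟫ - Real.cos ⟪f, W a⟫) ∂ρ)
          - ∫ ω, (Real.sin ⟪f, Y ω⟫ - Real.cos ⟪f, Y ω⟫) ∂P),
    sq_nonneg ((∫ a, ⟪f, W a⟫ ^ 2 ∂ρ) - sigmaSq Y P f)]

variable {Q : Measure H} [IsFiniteMeasure Q]

lemma integrable_zFun_sq (hY : MemLp Y 2 P) (hY₀ : mean Y P = 0) :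
    Integrable (fun f => zFun Y P f ^ 2) Q :=
  (MemLp.of_bound (p := 2) (measurable_zFun hY hY₀).aestronglyMeasurable 3
    (ae_of_all _ (abs_zFun_le_three hY))).integrable_sq

lemma abs_tau_sub_tau_sub_integral_influence_le (hsymm : Q.map (fun f => -f) = Q)
    (hQ : MemLp id 4 Q) (hX : MemLp X 2 P) (hW : MemLp W 2 ρ) :
    |tau Q W ρ - tau Q X P
        - ∫ a, influence Q (centred X P) P (W a - mean X P) ∂ρ|
      ≤ 72 * ∑ i, ∫ f,
        (∫ a, fluctuationKernel (centred X P) P i f (W a - mean X P) ∂ρ) ^ 2 ∂Q := by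
  have hQ₂ : MemLp id 2 Q := hQ.mono_exponent (by norm_num)
  have hY := memLp_centred hX
  have hY₀ := mean_centred (hX.integrable one_le_two)
  have hWm : MemLp (fun a => W a - mean X P) 2 ρ := hW.sub (memLp_const _)
  have hzW := integrable_zFun_sq (Q := Q) (memLp_centred hW)
    (mean_centred (hW.integrable one_le_two))
  have hzY := integrable_zFun_sq (Q := Q) hY hY₀
  have hlin : Integrable (fun f => 2 * (zFun (centred X P) P f
      * ∫ a, xi (centred X P) P f (W a - mean X P) ∂ρ)) Q := by
    simp_rw [← integral_const_mul (zFun _ _ _)]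
    exact ((((isCentredKernel_zFun_mul_xi hY hY₀).integral_right hWm).memLp_comp
      hQ₂ (by norm_num)).integrable le_rfl).const_mul 2
  have hdiff : Integrable (fun f => zFun (centred W ρ) ρ f ^ 2 - zFun (centred X P) P f ^ 2) Q :=
    hzW.sub hzY
  have hrem : ∀ i, Integrable (fun f =>
      (∫ a, fluctuationKernel (centred X P) P i f (W a - mean X P) ∂ρ) ^ 2) Q := fun i =>
    (((isCentredKernel_fluctuationKernel hY hY₀ i).integral_right hWm).memLp_comp (p := 2) hQ
      (by norm_num)).integrable_sq
  rw [tau_eq_integral_zFun_sq hsymm hW, tau_eq_integral_zFun_sq hsymm hX,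
    integral_influence_comp hY hY₀ hQ₂ hWm, ← integral_const_mul, ← integral_sub hzW hzY,
    ← integral_sub hdiff hlin, ← integral_finsetSum _ fun i _ => hrem i,
    ← integral_const_mul]
  refine norm_integral_le_of_norm_le (G := ℝ)
    ((integrable_finsetSum _ fun i _ => hrem i).const_mul 72) (ae_of_all _ fun f => ?_)
  rw [← mul_assoc, ← centred_sub_const (hW.integrable one_le_two) (mean X P)]
  exact abs_zFun_centred_sq_sub_zFun_sq_sub_le hY hY₀ hWm f

end VonMises

section Empirical

variable {ι : Type*} [MeasurableSpace ι] [MeasurableSingletonClass ι]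

lemma integral_uniformOn_univ [Fintype ι] {E : Type*} [NormedAddCommGroup E]
    [NormedSpace ℝ E] [CompleteSpace E] (g : ι → E) :
    ∫ i, g i ∂uniformOn Set.univ = (Fintype.card ι : ℝ)⁻¹ • ∑ i, g i := by
  rw [integral_fintype .of_finite, Finset.smul_sum]
  congr with i
  rw [measureReal_def, uniformOn_univ, Measure.count_singleton, one_div, ENNReal.toReal_inv,
    ENNReal.toReal_natCast]

variable {Ω Ω₀ : Type*} [MeasurableSpace Ω] [MeasurableSpace Ω₀] {P : Measure Ω} {P₀ : Measure Ω₀}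
  [IsFiniteMeasure P]

lemma integral_sq_integral_uniformOn_univ [Fintype ι] [Nonempty ι] {U : ι → Ω → ℝ}
    {U₀ : Ω₀ → ℝ}
    (hindep : Pairwise fun i j => IndepFun (U i) (U j) P)
    (hident : ∀ i, IdentDistrib (U i) U₀ P P₀) (hU : MemLp U₀ 2 P₀) (hU₀ : ∫ ω, U₀ ω ∂P₀ = 0) :
    ∫ ω, (∫ i, U i ω ∂uniformOn Set.univ) ^ 2 ∂P
      = (Fintype.card ι : ℝ)⁻¹ * ∫ ω, U₀ ω ^ 2 ∂P₀ := by
  have hmem : ∀ i, MemLp (U i) 2 P := fun i => (hident i).memLp_iff.2 hU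
  have hmean : ∫ ω, (∑ i, U i) ω ∂P = 0 := by
    simp_rw [Finset.sum_apply]
    rw [integral_finsetSum _ fun i _ => (hmem i).integrable one_le_two]
    exact Finset.sum_eq_zero fun i _ => (hident i).integral_eq.trans hU₀
  have hsum : ∫ ω, (∑ i, U i ω) ^ 2 ∂P = Fintype.card ι * ∫ ω, U₀ ω ^ 2 ∂P₀ := by
    calc ∫ ω, (∑ i, U i ω) ^ 2 ∂P = Var[∑ i, U i; P] := by
          rw [variance_of_integral_eq_zero _ hmean]
          · simp only [Finset.sum_apply]
          · exact Finset.aemeasurable_sum _ fun i _ => (hident i).aemeasurable_fst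
      _ = ∑ i, Var[U i; P] :=
          IndepFun.variance_sum (fun i _ => hmem i) fun i _ j _ hij => hindep hij
      _ = Fintype.card ι * ∫ ω, U₀ ω ^ 2 ∂P₀ := by
          simp_rw [(hident _).variance_eq, variance_of_integral_eq_zero hU.1.aemeasurable hU₀]
          rw [Finset.sum_const, Finset.card_univ, nsmul_eq_mul]
  simp_rw [integral_uniformOn_univ, smul_eq_mul, mul_pow]
  rw [integral_const_mul, hsum]
  field_simp

variable {E F : Type*} [NormedAddCommGroup E] [MeasurableSpace E] [BorelSpace E]
  [NormedAddCommGroup F] [MeasurableSpace F] [BorelSpace F] {Q : Measure E}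
  [IsFiniteMeasure Q] {Ys : ι → Ω → F} {h : E → F → ℝ}

lemma IsQuadraticKernel.integrable_sq_integral_uniformOn_univ [Finite ι]
    (hh : IsQuadraticKernel h) (hQ : MemLp id 4 Q) (hYs : ∀ i, MemLp (Ys i) 4 P) :
    Integrable (fun p : Ω × E => (∫ i, h p.2 (Ys i p.1) ∂uniformOn Set.univ) ^ 2)
      (P.prod Q) := by
  have := Fintype.ofFinite ι
  have hsum : MemLp (fun p : Ω × E => ∑ i, h p.2 (Ys i p.1)) 2 (P.prod Q) :=
    memLp_finsetSum _ fun i _ => hh.swap.memLp_prod two_ne_zero ENNReal.ofNat_ne_top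
      (hYs i) hQ (by norm_num)
  simp_rw [integral_uniformOn_univ, smul_eq_mul]
  exact (hsum.const_mul _).integrable_sq

lemma IsCentredKernel.integral_integral_sq_integral_uniformOn_univ [Fintype ι] [Nonempty ι]
    [IsFiniteMeasure P₀] {Y : Ω₀ → F} (hh : IsCentredKernel Y P₀ h)
    (hindep : Pairwise fun i j => IndepFun (Ys i) (Ys j) P)
    (hident : ∀ i, IdentDistrib (Ys i) Y P P₀) (hQ : MemLp id 4 Q) (hY : MemLp Y 4 P₀) :
    ∫ ω, ∫ x, (∫ i, h x (Ys i ω) ∂uniformOn Set.univ) ^ 2 ∂Q ∂P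
      = (Fintype.card ι : ℝ)⁻¹ * ∫ x, ∫ ω, h x (Y ω) ^ 2 ∂P₀ ∂Q := by
  have hYs : ∀ i, MemLp (Ys i) 4 P := fun i => (hident i).memLp_iff.2 hY
  rw [integral_integral_swap (hh.toIsQuadraticKernel.integrable_sq_integral_uniformOn_univ hQ hYs),
    ← integral_const_mul]
  congr with x
  have hx := (hh.section_right x).measurable
  exact integral_sq_integral_uniformOn_univ (fun i j hij => (hindep hij).comp hx hx)
    (fun i => (hident i).comp hx) (hh.memLp_comp hY (by norm_num) x) (hh.integral_eq_zero x)

end Empirical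

section Sample

variable {H : Type*} [NormedAddCommGroup H] [InnerProductSpace ℝ H] {n : ℕ}

lemma sampleMean_eq_mean [CompleteSpace H] (x : Fin n → H) :
    sampleMean x = mean x (uniformOn Set.univ) := by
  rw [sampleMean, mean, integral_uniformOn_univ, Fintype.card_fin]

lemma sampleCovOp_eq_covOp [CompleteSpace H] [NeZero n] (x : Fin n → H) :
    sampleCovOp x = covOp x (uniformOn Set.univ) := by
  ext f
  set m := mean x (uniformOn Set.univ) with hm
  have hzero : ∫ j, ⟪x j - m, f⟫ ∂uniformOn Set.univ = 0 := by
    simp_rw [real_inner_comm f]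
    exact integral_inner_eq_zero .of_finite (mean_centred .of_finite) f
  rw [sampleCovOp, sampleMean_eq_mean, covOp, ← hm]
  calc (n : ℝ)⁻¹ • ∑ j, ⟪x j - m, f⟫ • (x j - m)
      = ∫ j, (⟪x j - m, f⟫ • x j - ⟪x j - m, f⟫ • m) ∂uniformOn Set.univ := by
        simp_rw [integral_uniformOn_univ, Fintype.card_fin, smul_sub]
    _ = ∫ j, ⟪x j - m, f⟫ • x j ∂uniformOn Set.univ := by
        rw [integral_sub .of_finite .of_finite, integral_smul_const, hzero, zero_smul, sub_zero]

lemma empCharFunctional_eq_charFunctional (x : Fin n → H) :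
    empCharFunctional x = charFunctional x (uniformOn Set.univ) := by
  ext f
  simp_rw [empCharFunctional, charFunctional, integral_uniformOn_univ, Fintype.card_fin,
    Complex.real_smul, real_inner_comm f]
  push_cast
  rfl

lemma Tstat_eq_tau [CompleteSpace H] [NeZero n] [MeasurableSpace H] (Q : Measure H)
    (x : Fin n → H) : Tstat Q x = tau Q x (uniformOn Set.univ) := by
  rw [Tstat, tau, sampleMean_eq_mean, sampleCovOp_eq_covOp, empCharFunctional_eq_charFunctional]

lemma measurable_Tstat [SecondCountableTopology H] [MeasurableSpace H] [BorelSpace H]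
    (Q : Measure H) [SFinite Q] : Measurable fun x : Fin n → H => Tstat Q x := by
  have hcont : Continuous fun p : (Fin n → H) × H =>
      ‖empCharFunctional p.1 p.2 - gaussCharFun (sampleMean p.1) (sampleCovOp p.1) p.2‖ ^ 2 := by
    unfold empCharFunctional gaussCharFun sampleCovOp sampleMean
    fun_prop
  exact (hcont.measurable.stronglyMeasurable.integral_prod_right' (ν := Q)).measurable

end Sample

section Limit

variable {H : Type*} [NormedAddCommGroup H] [InnerProductSpace ℝ H] [CompleteSpace H]
  [SecondCountableTopology H] [MeasurableSpace H] [BorelSpace H]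
  {Ω₀ : Type*} [MeasurableSpace Ω₀] {P₀ : Measure Ω₀} [IsProbabilityMeasure P₀]
  {Ω : Type*} [MeasurableSpace Ω] {P : Measure Ω} [IsProbabilityMeasure P]
  {X : Ω₀ → H} {Q : Measure H} [IsFiniteMeasure Q]

lemma abs_Tstat_sub_tau_sub_sum_influence_le {n : ℕ} [NeZero n]
    (hsymm : Q.map (fun f => -f) = Q) (hQ : MemLp id 4 Q) (hX : MemLp X 2 P₀) (x : Fin n → H) :
    |Tstat Q x - tau Q X P₀
        - (n : ℝ)⁻¹ * ∑ j, influence Q (centred X P₀) P₀ (x j - mean X P₀)|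
      ≤ 72 * ∑ i, ∫ f, (∫ j, fluctuationKernel (centred X P₀) P₀ i f (x j - mean X P₀)
        ∂uniformOn Set.univ) ^ 2 ∂Q := by
  have havg : (n : ℝ)⁻¹ * ∑ j, influence Q (centred X P₀) P₀ (x j - mean X P₀)
      = ∫ j, influence Q (centred X P₀) P₀ (x j - mean X P₀) ∂uniformOn Set.univ := by
    rw [integral_uniformOn_univ, Fintype.card_fin, smul_eq_mul]
  rw [Tstat_eq_tau, havg]
  exact abs_tau_sub_tau_sub_integral_influence_le hsymm hQ hX .of_discrete

lemma eLpNorm_Tstat_sub_tau_sub_sum_influence_le {n : ℕ} [NeZero n] {Xs : Fin n → Ω → H}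
    (hindep : Pairwise fun i j => IndepFun (Xs i) (Xs j) P)
    (hident : ∀ j, IdentDistrib (Xs j) X P P₀) (hX : MemLp X 4 P₀)
    (hsymm : Q.map (fun f => -f) = Q) (hQ : MemLp id 4 Q) :
    eLpNorm (fun ω => Tstat Q (fun j => Xs j ω) - tau Q X P₀
        - (n : ℝ)⁻¹ * ∑ j, influence Q (centred X P₀) P₀ (Xs j ω - mean X P₀)) 1 P
      ≤ ENNReal.ofReal ((n : ℝ)⁻¹ * (72 * ∑ i, ∫ f, ∫ ω,
        fluctuationKernel (centred X P₀) P₀ i f (centred X P₀ ω) ^ 2 ∂P₀ ∂Q)) := by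
  have hX₂ : MemLp X 2 P₀ := hX.mono_exponent (by norm_num)
  have hY := memLp_centred hX
  have hker := isCentredKernel_fluctuationKernel (memLp_centred hX₂)
    (mean_centred (hX₂.integrable one_le_two))
  have hshift : Measurable fun x : H => x - mean X P₀ := measurable_id.sub_const _
  have hindepY : Pairwise fun i j =>
      IndepFun (fun ω => Xs i ω - mean X P₀) (fun ω => Xs j ω - mean X P₀) P :=
    fun i j hij => (hindep hij).comp hshift hshift
  have hidentY : ∀ j, IdentDistrib (fun ω => Xs j ω - mean X P₀) (centred X P₀) P P₀ :=
    fun j => (hident j).comp hshift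
  have hint : ∀ i, Integrable (fun ω => ∫ f, (∫ j, fluctuationKernel (centred X P₀) P₀ i f
      (Xs j ω - mean X P₀) ∂uniformOn Set.univ) ^ 2 ∂Q) P := fun i =>
    ((hker i).toIsQuadraticKernel.integrable_sq_integral_uniformOn_univ hQ fun j =>
      (hidentY j).memLp_iff.2 hY).integral_prod_left
  have hbound : Integrable (fun ω => 72 * ∑ i, ∫ f, (∫ j, fluctuationKernel (centred X P₀) P₀ i f
      (Xs j ω - mean X P₀) ∂uniformOn Set.univ) ^ 2 ∂Q) P :=
    (integrable_finsetSum _ fun i _ => hint i).const_mul 72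
  calc eLpNorm (fun ω => Tstat Q (fun j => Xs j ω) - tau Q X P₀
        - (n : ℝ)⁻¹ * ∑ j, influence Q (centred X P₀) P₀ (Xs j ω - mean X P₀)) 1 P
      ≤ ENNReal.ofReal (∫ ω, 72 * ∑ i, ∫ f, (∫ j, fluctuationKernel (centred X P₀) P₀ i f
        (Xs j ω - mean X P₀) ∂uniformOn Set.univ) ^ 2 ∂Q ∂P) := by
        rw [eLpNorm_one_eq_lintegral_enorm,
          ofReal_integral_eq_lintegral_ofReal hbound (ae_of_all _ fun ω => by positivity)]
        refine lintegral_mono fun ω => ?_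
        rw [Real.enorm_eq_ofReal_abs]
        exact ENNReal.ofReal_le_ofReal (abs_Tstat_sub_tau_sub_sum_influence_le hsymm hQ hX₂ _)
    _ = _ := by
        rw [integral_const_mul, integral_finsetSum _ fun i _ => hint i]
        rw [mul_left_comm, Finset.mul_sum _ _ (n : ℝ)⁻¹]
        congr with i
        rw [(hker i).integral_integral_sq_integral_uniformOn_univ hindepY hidentY hQ hY,
          Fintype.card_fin]

lemma tendsto_eLpNorm_sqrt_mul_Tstat_sub_sum_influence {Xs : ℕ → Ω → H}
    (hindep : Pairwise fun i j => IndepFun (Xs i) (Xs j) P)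
    (hident : ∀ j, IdentDistrib (Xs j) X P P₀) (hX : MemLp X 4 P₀)
    (hsymm : Q.map (fun f => -f) = Q) (hQ : MemLp id 4 Q) :
    Tendsto (fun n : ℕ => eLpNorm (fun ω => √(n : ℝ) * (Tstat Q (fun j : Fin n => Xs j ω)
        - tau Q X P₀) - (√(n : ℝ))⁻¹ * ∑ j ∈ Finset.range n,
          influence Q (centred X P₀) P₀ (Xs j ω - mean X P₀)) 1 P) atTop (𝓝 0) := by
  set C := 72 * ∑ i, ∫ f, ∫ ω,
    fluctuationKernel (centred X P₀) P₀ i f (centred X P₀ ω) ^ 2 ∂P₀ ∂Q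
  have hlim : Tendsto (fun n : ℕ => ENNReal.ofReal ((√(n : ℝ))⁻¹ * C)) atTop (𝓝 0) := by
    rw [← ENNReal.ofReal_zero, ← zero_mul C]
    exact ENNReal.tendsto_ofReal ((tendsto_inv_atTop_zero.comp
      (Real.tendsto_sqrt_atTop.comp tendsto_natCast_atTop_atTop)).mul_const _)
  refine tendsto_of_tendsto_of_tendsto_of_le_of_le' tendsto_const_nhds hlim
    (Eventually.of_forall fun n => zero_le) ?_
  filter_upwards [eventually_ne_atTop 0] with n hn
  have := NeZero.mk hn
  have hsqrt : (√(n : ℝ))⁻¹ = √(n : ℝ) * (n : ℝ)⁻¹ := by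
    rw [← div_eq_mul_inv, Real.sqrt_div_self', one_div]
  simp_rw [hsqrt, mul_assoc, ← mul_sub, Finset.sum_range]
  rw [ENNReal.ofReal_mul (Real.sqrt_nonneg _), ← Real.enorm_of_nonneg (Real.sqrt_nonneg _)]
  refine (eLpNorm_const_smul (√(n : ℝ)) _ 1 P).trans_le ?_
  gcongr
  exact eLpNorm_Tstat_sub_tau_sub_sum_influence_le
    (fun i j hij => hindep (Fin.val_injective.ne hij)) (fun j => hident j) hX hsymm hQ

lemma tendstoInDistribution_inv_sqrt_mul_sum_influence {Xs : ℕ → Ω → H}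
    (hindep : iIndepFun Xs P) (hident : ∀ j, IdentDistrib (Xs j) X P P₀) (hX : MemLp X 4 P₀)
    (hQ : MemLp id 2 Q) {v : ℝ≥0}
    (hv : (v : ℝ) = ∫ ω, influence Q (centred X P₀) P₀ (centred X P₀ ω) ^ 2 ∂P₀) :
    TendstoInDistribution (fun (n : ℕ) ω => (√(n : ℝ))⁻¹ * ∑ j ∈ Finset.range n,
        influence Q (centred X P₀) P₀ (Xs j ω - mean X P₀))
      atTop (id : ℝ → ℝ) (fun _ => P) (gaussianReal 0 v) := by
  have hX₂ : MemLp X 2 P₀ := hX.mono_exponent (by norm_num)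
  have hY := memLp_centred hX₂
  have hY₀ := mean_centred (hX₂.integrable one_le_two)
  set Y := centred X P₀
  have hgrowth := hasQuadraticGrowth_influence hY hY₀ hQ
  have hmeas : Measurable fun x : H => influence Q Y P₀ (x - mean X P₀) :=
    hgrowth.measurable.comp (measurable_id.sub_const _)
  have hid : ∀ j, IdentDistrib (fun ω => influence Q Y P₀ (Xs j ω - mean X P₀))
      (fun ω => influence Q Y P₀ (Y ω)) P P₀ := fun j => (hident j).comp hmeas
  have hmem : MemLp (fun ω => influence Q Y P₀ (Y ω)) 2 P₀ :=
    hgrowth.memLp_comp (memLp_centred hX) (by norm_num)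
  have hzero := integral_influence_eq_zero hY hY₀ hQ
  have hmean : ∫ ω, influence Q Y P₀ (Xs 0 ω - mean X P₀) ∂P = 0 :=
    (hid 0).integral_eq.trans hzero
  have hvar : Var[fun ω => influence Q Y P₀ (Xs 0 ω - mean X P₀); P] = v := by
    rw [(hid 0).variance_eq, variance_of_integral_eq_zero hmem.1.aemeasurable hzero, hv]
  have hclt := tendstoInDistribution_inv_sqrt_mul_sum_sub (P := P) (P' := gaussianReal 0 v)
    (X := fun j ω => influence Q Y P₀ (Xs j ω - mean X P₀)) (Y := id)
    (by rw [hvar, Real.toNNReal_coe]; exact HasLaw.id) ((hid 0).memLp_iff.2 hmem)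
    (hindep.comp (fun _ x => influence Q Y P₀ (x - mean X P₀)) fun _ => hmeas)
    (fun j => (hid j).trans (hid 0).symm)
  simpa only [hmean, mul_zero, sub_zero] using hclt

theorem tendstoInDistribution_sqrt_mul_Tstat_sub_tau {Xs : ℕ → Ω → H}
    (hindep : iIndepFun Xs P) (hident : ∀ j, IdentDistrib (Xs j) X P P₀) (hX : MemLp X 4 P₀)
    (hsymm : Q.map (fun f => -f) = Q) (hQ : MemLp id 4 Q) {v : ℝ≥0}
    (hv : (v : ℝ) = ∫ ω, influence Q (centred X P₀) P₀ (centred X P₀ ω) ^ 2 ∂P₀) :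
    TendstoInDistribution (fun (n : ℕ) (ω : Ω) => √(n : ℝ) *
        (Tstat Q (fun j : Fin n => Xs j ω) - tau Q X P₀))
      atTop (id : ℝ → ℝ) (fun _ => P) (gaussianReal 0 v) := by
  have hclt := tendstoInDistribution_inv_sqrt_mul_sum_influence hindep hident hX
    (hQ.mono_exponent (by norm_num)) hv
  have hT : ∀ n : ℕ, AEMeasurable (fun ω => √(n : ℝ) *
      (Tstat Q (fun j : Fin n => Xs j ω) - tau Q X P₀)) P := fun n =>
    (((measurable_Tstat Q).comp_aemeasurable (aemeasurable_pi_lambda _ fun j : Fin n =>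
      (hident j).aemeasurable_fst)).sub_const _).const_mul _
  refine tendstoInDistribution_of_tendstoInMeasure_sub _ _ hclt ?_ hT
  refine tendstoInMeasure_of_tendsto_eLpNorm one_ne_zero
    (fun n => ((hT n).sub (hclt.forall_aemeasurable n)).aestronglyMeasurable)
    aestronglyMeasurable_zero ?_
  simp only [sub_zero]
  exact tendsto_eLpNorm_sqrt_mul_Tstat_sub_sum_influence
    (fun i j hij => hindep.indepFun hij) hident hX hsymm hQ

end Limit

end GaussTest

theorem mainTheorem4
    {H : Type*} [NormedAddCommGroup H] [InnerProductSpace ℝ H] [CompleteSpace H]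
    [SecondCountableTopology H] [MeasurableSpace H] [BorelSpace H]
    {Ω₀ : Type*} [MeasurableSpace Ω₀] (P₀ : Measure Ω₀) [IsProbabilityMeasure P₀]
    {Ω : Type*} [MeasurableSpace Ω] (P : Measure Ω) [IsProbabilityMeasure P]
    -- the random element `X` and its iid copies
    (X : Ω₀ → H) (Xs : ℕ → Ω → H)
    (hindep : iIndepFun Xs P)
    (hident : ∀ j, IdentDistrib (Xs j) X P P₀)
    (hX : Integrable (fun ω => ‖X ω‖ ^ 4) P₀)
    -- the symmetric weight measure `Q`
    (Q : Measure H) [IsProbabilityMeasure Q]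
    (hsymm : Q.map (fun f => -f) = Q)
    (hQ : Integrable (fun f => ‖f‖ ^ 4) Q) :
    -- the integrals that define the variance converge
    (∀ f g : H, Integrable (fun ω =>
      GaussTest.xi (GaussTest.centred X P₀) P₀ f (GaussTest.centred X P₀ ω) *
        GaussTest.xi (GaussTest.centred X P₀) P₀ g (GaussTest.centred X P₀ ω)) P₀) ∧
    Integrable (fun p : H × H =>
      GaussTest.Kstar (GaussTest.centred X P₀) P₀ p.1 p.2 *
        GaussTest.zFun (GaussTest.centred X P₀) P₀ p.1 *
        GaussTest.zFun (GaussTest.centred X P₀) P₀ p.2) (Q.prod Q) ∧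
    ∃ v : ℝ≥0,
      (v : ℝ) = 4 * ∫ g, ∫ f, GaussTest.Kstar (GaussTest.centred X P₀) P₀ f g *
        GaussTest.zFun (GaussTest.centred X P₀) P₀ f *
        GaussTest.zFun (GaussTest.centred X P₀) P₀ g ∂Q ∂Q ∧
      TendstoInDistribution
        (fun (n : ℕ) (ω : Ω) => √(n : ℝ) *
          (GaussTest.Tstat Q (fun j : Fin n => Xs j ω) - GaussTest.tau Q X P₀))
        atTop (id : ℝ → ℝ) (fun _ => P) (gaussianReal 0 v) := by
  have hX₄ : MemLp X 4 P₀ := GaussTest.memLp_natCast_of_integrable_norm_pow four_ne_zero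
    (hident 0).aemeasurable_snd.aestronglyMeasurable hX
  have hQ₄ : MemLp id 4 Q :=
    GaussTest.memLp_natCast_of_integrable_norm_pow four_ne_zero aestronglyMeasurable_id hQ
  have hQ₂ : MemLp id 2 Q := hQ₄.mono_exponent (by norm_num)
  have hY := GaussTest.memLp_centred hX₄
  have hY₀ := GaussTest.mean_centred (hX₄.integrable (by norm_num))
  have hvar := GaussTest.integral_influence_sq hY hY₀ hQ₂
  refine ⟨GaussTest.integrable_xi_mul_xi hY hY₀,
    GaussTest.integrable_Kstar_mul_zFun_mul_zFun hY hY₀ hQ₂,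
    ⟨_, integral_nonneg fun _ => sq_nonneg _⟩, hvar, ?_⟩
  exact GaussTest.tendstoInDistribution_sqrt_mul_Tstat_sub_tau hindep hident hX₄ hsymm hQ₄ rfl
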